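/- Let $V$ be a finite-dimensional real vector space, $R=\mathbb{R}[[V^*]]$ the ring of formal power series on $V$ (i.e. $R=\mathbb R[[x_i : i\in\iota]]$ in linear coordinates on $V$), $I\subset R$ the ideal of series with vanishing constant term, and let $\mathfrak{k}$ be a compact simple real Lie algebra. Let $\mathfrak{g}=R\otimes\mathfrak{k}$ with bracket $[f\otimes X,g\otimes Y]=fg\otimes[X,Y]$ and the product topology (coefficientwise convergence), let $\mathrm{ev}_0:\mathfrak g\to\mathfrak k$ be evaluation at the origin, and regard $\mathfrak{k}\subset\mathfrak{g}$ as the constant series. Let $\mathcal{X}_I$ be the Lie algebra of formal vector fields on $V$ vanishing at $0$, identified via the Lie derivative $v\mapsto\mathcal L_v$ with the Lie algebra of derivations of $R$ preserving $I$; $\mathcal L_v$ acts on $\mathfrak g$ as $\mathcal L_v\otimes\mathrm{id}_{\mathfrak k}$. Let $\mathfrak{p}$ be a finite-dimensional semisimple real Lie algebra, and let $\boldsymbol{v}:\mathfrak{p}\to\mathcal{X}_I^{\mathrm{op}}$ be a Lie algebra homomorphism, i.e. $\boldsymbol v$ is linear with $\boldsymbol v([p,q])=[\boldsymbol v(q),\boldsymbol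 v(p)]$. A linear map $\sigma:\mathfrak{p}\to\mathfrak{g}$ is said to satisfy the Maurer–Cartan equation if $$-\mathcal{L}_{\boldsymbol v(p)}\sigma(q)+\mathcal{L}_{\boldsymbol v(q)}\sigma(p)-\sigma([p,q])+[\sigma(p),\sigma(q)]=0\qquad\text{for all }p,q\in\mathfrak{p}.$$ Two linear maps $\sigma,\eta:\mathfrak{p}\to\mathfrak{g}$ satisfying this equation are called gauge-equivalent if there is $\xi\in\mathfrak{g}$ with $$\eta(p)=e^{\mathrm{ad}_\xi}\sigma(p)+F(\mathrm{ad}_\xi)\bigl(-\mathcal{L}_{\boldsymbol v(p)}\xi\bigr)\qquad\text{for all }p\in\mathfrak{p},$$ where $F(w)=-\sum_{n\ge 0}\frac{1}{(n+1)!}w^n$ and both operator series are evaluated as convergent series in $\mathfrak g$. **Theorem.** Let the linear map $\sigma:\mathfrak{p}\to\mathfrak{g}$ satisfy the Maurer–Cartan equation. Then $\sigma_0:=\mathrm{ev}_0\circ\sigma:\mathfrak{p}\to\mathfrak{k}$ is a homomorphism of Lie algebras, and $\sigma$ is gauge-equivalent to $\sigma_0$. If, moreover, $\mathfrak{p}$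 has no non-zero compact ideal, then $\sigma$ is gauge-equivalent to $0$. Here a finite-dimensional real Lie algebra is called compact if it admits an inner product for which all operators $\mathrm{ad}_x$ are skew-symmetric. -/

import Mathlib

open scoped TensorProduct Nat

noncomputable section

namespace JetAlgebra

/-- The ring `R = ℝ⟦V*⟧` of formal power series on the finite-dimensional real vector space `V`,
written in the linear coordinates `(x_i)_{i ∈ ι}` given by a basis of `V`. -/
abbrev FormalSeries (ι : Type*) := MvPowerSeries ι ℝ

/-- The Lie algebra `𝔤 = R ⊗ 𝔨`, with bracket `[f ⊗ X, g ⊗ Y] = fg ⊗ [X, Y]`. -/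
abbrev Jet (ι : Type*) (𝔨 : Type*) [LieRing 𝔨] [LieAlgebra ℝ 𝔨] := FormalSeries ι ⊗[ℝ] 𝔨

/-- The Lie algebra `𝒳_I` of formal vector fields vanishing at the origin. A vector field is
identified with its Lie derivative: an element is a derivation of `R` that preserves the
ideal `I` of power series without constant term, and the bracket is the commutator. (Such a
derivation is automatically `f ↦ ∑ i, v_i ∂f/∂x_i`, with `v_i ∈ I` its value at `x_i`.) -/
def VectorFields (ι : Type*) : LieSubalgebra ℝ (Derivation ℝ (FormalSeries ι) (FormalSeries ι)) where
  carrier := {D | ∀ f : FormalSeries ι,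
    MvPowerSeries.constantCoeff f = 0 → MvPowerSeries.constantCoeff (D f) = 0}
  add_mem' := by
    intro D E hD hE f hf
    simp [hD f hf, hE f hf]
  zero_mem' := by
    intro f _
    simp
  smul_mem' := by
    intro c D hD f hf
    simp [hD f hf]
  lie_mem' := by
    intro D E hD hE f hf
    rw [Derivation.commutator_apply, map_sub, hD _ (hE f hf), hE _ (hD f hf), sub_zero]

variable {ι : Type*} {𝔨 𝔭 : Type*} [LieRing 𝔨] [LieAlgebra ℝ 𝔨] [LieRing 𝔭] [LieAlgebra ℝ 𝔭]

/-- The Lie derivative `ℒ_v = ℒ_v ⊗ id` on `𝔤 = R ⊗ 𝔨`. -/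
def lieDeriv (v : VectorFields ι) : Jet ι 𝔨 →ₗ[ℝ] Jet ι 𝔨 :=
  LinearMap.rTensor 𝔨 (v : Derivation ℝ (FormalSeries ι) (FormalSeries ι)).toLinearMap

/-- The `m`-th coefficient, an element of `𝔨`, of a `𝔨`-valued formal power series. -/
def coeffAt (m : ι →₀ ℕ) : Jet ι 𝔨 →ₗ[ℝ] 𝔨 :=
  (TensorProduct.lid ℝ 𝔨).toLinearMap ∘ₗ LinearMap.rTensor 𝔨 (MvPowerSeries.coeff m)

/-- Evaluation at the origin, `ev₀ : 𝔤 → 𝔨`. -/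
def ev₀ : Jet ι 𝔨 →ₗ[ℝ] 𝔨 := coeffAt 0

/-- The inclusion `X ↦ 1 ⊗ X` of `𝔨` into `𝔤` as the constant power series. -/
def const : 𝔨 →ₗ[ℝ] Jet ι 𝔨 := TensorProduct.mk ℝ (FormalSeries ι) 𝔨 1

/-- The product topology on `𝔤`: convergence of every coefficient in `𝔨`, where the
finite-dimensional space `𝔨` has its canonical vector space topology. -/
instance jetTopology : TopologicalSpace (Jet ι 𝔨) :=
  ⨅ m : ι →₀ ℕ, TopologicalSpace.induced (coeffAt m) (moduleTopology ℝ 𝔨)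

/-- The Maurer-Cartan equation
`-ℒ_{v(p)} σ(q) + ℒ_{v(q)} σ(p) - σ([p, q]) + [σ(p), σ(q)] = 0`. -/
def MaurerCartan (v : 𝔭 →ₗ[ℝ] VectorFields ι) (σ : 𝔭 →ₗ[ℝ] Jet ι 𝔨) : Prop :=
  ∀ p q : 𝔭, -lieDeriv (v p) (σ q) + lieDeriv (v q) (σ p) - σ ⁅p, q⁆ + ⁅σ p, σ q⁆ = 0

/-- `η = e^{ad ξ} ξ'`, as the sum of a convergent series in `𝔤`. -/
def IsExpAd (ξ ξ' η : Jet ι 𝔨) : Prop :=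
  HasSum (fun n : ℕ => (n ! : ℝ)⁻¹ • ((LieAlgebra.ad (FormalSeries ι) (Jet ι 𝔨) ξ) ^ n) ξ') η

/-- `η = F(ad ξ) ξ'` with `F(w) = -∑ₙ wⁿ / (n + 1)!`, as the sum of a convergent series in `𝔤`. -/
def IsFAd (ξ ξ' η : Jet ι 𝔨) : Prop :=
  HasSum (fun n : ℕ => -(((n + 1)! : ℝ)⁻¹ •
    ((LieAlgebra.ad (FormalSeries ι) (Jet ι 𝔨) ξ) ^ n) ξ')) η

/-- Gauge equivalence of two solutions `σ`, `η` of the Maurer-Cartan equation: for some `ξ ∈ 𝔤`,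
`η(p) = e^{ad ξ} σ(p) + F(ad ξ)(-ℒ_{v(p)} ξ)` for all `p`. -/
def GaugeEquivalent (v : 𝔭 →ₗ[ℝ] VectorFields ι) (σ η : 𝔭 →ₗ[ℝ] Jet ι 𝔨) : Prop :=
  MaurerCartan v σ ∧ MaurerCartan v η ∧
    ∃ ξ : Jet ι 𝔨, ∀ p : 𝔭, ∃ a b : Jet ι 𝔨,
      IsExpAd ξ (σ p) a ∧ IsFAd ξ (-lieDeriv (v p) ξ) b ∧ η p = a + b

/-- A (finite-dimensional) real Lie algebra is compact if it carries an inner product for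
which all `ad x` are skew-symmetric. -/
def IsCompactLieAlgebra (L : Type*) [LieRing L] [LieAlgebra ℝ L] : Prop :=
  ∃ B : LinearMap.BilinForm ℝ L, B.IsSymm ∧ (∀ x : L, x ≠ 0 → 0 < B x x) ∧
    ∀ x y z : L, B ⁅x, y⁆ z = -B y ⁅x, z⁆

end JetAlgebra

end

/-! Let `𝔭` act on `𝔤` by the derivations `-ℒ_{v(p)}`. The Maurer-Cartan equation for `σ` says
exactly that `p ↦ (σ p, p)` is a homomorphism from `𝔭` to the semidirect sum `𝔤 ⋊ 𝔭`, and a gauge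
transformation by `ξ` is the `𝔤`-component of conjugation by `exp (ad (ξ, 0))`. So it suffices to
conjugate two such homomorphisms that agree at the origin.

Filter `𝔤` by order of vanishing, which formal vector fields vanishing at `0` preserve. If two
homomorphisms agree up to order `k + 1` after conjugation, their difference is a 1-cocycle modulo
order `k + 2`. Each graded piece is finite-dimensional, so Whitehead's first lemma
(`exists_eq_lie_of_cocycle`, proved with a Casimir operator) makes it a coboundary, and the
primitive corrects the conjugating element (`exists_correction`). Completeness gives a limit
(`exists_expAdPartial_sub_mem`), and `exists_gauge_sub_mem` translates this back to gauge
equivalence.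

Applied to `σ` and the constant solution `σ₀`, this gives the first claim. For the second, an ideal
complementary to `ker σ₀` embeds in `𝔨`, hence is compact, hence zero; so `σ₀ = 0`. -/

namespace LieAlgebra.IsSemisimple

/-! ### Ideals of semisimple Lie algebras and the trace form -/

variable {K L : Type*} [Field K] [LieRing L] [LieAlgebra K L]

lemma lie_self_eq [IsSemisimple K L] (I : LieIdeal K L) : ⁅I, I⁆ = I := by
  refine le_antisymm (LieSubmodule.lie_le_left I I) ?_
  obtain ⟨C, hC⟩ := exists_isCompl (⁅I, I⁆ : LieIdeal K L)
  -- Brackets of elements of `I ⊓ C` lie in both `⁅I, I⁆` and its complement `C`, so `I ⊓ C` is an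
  -- abelian ideal.
  have hJ : I ⊓ C = ⊥ := by
    apply (hasTrivialRadical_iff_no_abelian_ideals K L).mp inferInstance
    rw [LieSubmodule.lie_abelian_iff_lie_self_eq_bot, eq_bot_iff, ← hC.inf_eq_bot]
    exact le_inf (LieSubmodule.mono_lie inf_le_left inf_le_left)
      ((LieSubmodule.lie_le_left _ _).trans inf_le_right)
  have h := hC.sup_eq_top
  calc I = I ⊓ (⁅I, I⁆ ⊔ C) := by rw [h, inf_top_eq]
    _ = (I ⊓ ⁅I, I⁆) ⊔ (I ⊓ C) := inf_sup_left _ _ _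
    _ ≤ ⁅I, I⁆ := by rw [hJ, sup_bot_eq]; exact inf_le_right

/-- In a semisimple Lie algebra every ideal is spanned by the brackets of its elements. -/
lemma mem_span_lie [IsSemisimple K L] (I : LieIdeal K L) {x : L} (hx : x ∈ I) :
    x ∈ Submodule.span K {z : L | ∃ a ∈ I, ∃ b ∈ I, ⁅a, b⁆ = z} := by
  have h : x ∈ (⁅I, I⁆ : LieIdeal K L) := by rwa [lie_self_eq]
  rw [← LieSubmodule.mem_toSubmodule, LieSubmodule.lieIdeal_oper_eq_linear_span'] at h
  exact h

lemma derivedSeries_one_eq_top [IsSemisimple K L] (I : LieIdeal K L) :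
    derivedSeries K I 1 = ⊤ := by
  rw [LieIdeal.derivedSeries_eq_derivedSeriesOfIdeal_comap]
  simp [derivedSeriesOfIdeal_succ, lie_self_eq, LieIdeal.comap_incl_self]

variable {M : Type*} [AddCommGroup M] [Module K M] [LieRingModule L M] [LieModule K L M]

/-- An ideal of a semisimple Lie algebra with vanishing trace form acts trivially. -/
lemma lie_eq_zero_of_traceForm_eq_zero [CharZero K] [FiniteDimensional K M] [IsSemisimple K L]
    (I : LieIdeal K L) (h : ∀ x ∈ I, ∀ y ∈ I, LieModule.traceForm K L M x y = 0)
    {x : L} (hx : x ∈ I) (m : M) : ⁅x, m⁆ = 0 := by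
  have htf : LieModule.traceForm K I M = 0 := by
    ext ⟨x, hx⟩ ⟨y, hy⟩
    exact h x hx y hy
  have hn := LieModule.isNilpotent_derivedSeries_of_traceForm_eq_zero htf
  have hnil : LieModule.IsNilpotent I M := by
    rw [LieModule.isNilpotent_iff_forall' (R := K)] at hn ⊢
    intro y
    exact hn ⟨y, by rw [derivedSeries_one_eq_top]; trivial⟩
  -- Since `I` is perfect, write `y` as a sum of brackets: `⁅⁅a, b⁆, m⁆ = ⁅a, ⁅b, m⁆⁆ - ⁅b, ⁅a, m⁆⁆`
  -- lies one step deeper. Nilpotency then forces `⁅y, m⁆ = 0`.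
  have key : ∀ k, ∀ y ∈ I, ∀ m : M, ⁅y, m⁆ ∈ LieModule.lowerCentralSeries K I M k := by
    intro k
    induction k with
    | zero => intro y _ m; simp
    | succ k ih =>
      intro y hy m
      have hy' := mem_span_lie I hy
      induction hy' using Submodule.span_induction with
      | mem z hz =>
        obtain ⟨a, ha, b, hb, rfl⟩ := hz
        rw [lie_lie, LieModule.lowerCentralSeries_succ]
        exact sub_mem
          (LieSubmodule.lie_mem_lie (LieSubmodule.mem_top (⟨a, ha⟩ : I)) (ih b hb m))
          (LieSubmodule.lie_mem_lie (LieSubmodule.mem_top (⟨b, hb⟩ : I)) (ih a ha m))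
      | zero => simp
      | add a b ha hb iha ihb =>
        rw [add_lie]
        exact add_mem (iha (Submodule.span_le.mpr (by
          rintro _ ⟨u, hu, w, hw, rfl⟩; exact I.lie_mem hw) ha)) (ihb (Submodule.span_le.mpr (by
          rintro _ ⟨u, hu, w, hw, rfl⟩; exact I.lie_mem hw) hb))
      | smul c a ha iha =>
        rw [smul_lie]
        exact Submodule.smul_mem _ c (iha (Submodule.span_le.mpr (by
          rintro _ ⟨u, hu, w, hw, rfl⟩; exact I.lie_mem hw) ha))
  obtain ⟨k, hk⟩ := (LieModule.isNilpotent_iff K I M).mp hnil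
  simpa [hk] using key k x hx m

end LieAlgebra.IsSemisimple

/-! ### Casimir operators and Whitehead's first lemma -/

namespace LieModule

open LieAlgebra Module

variable {K L M : Type*} [Field K] [LieRing L] [LieAlgebra K L]
  [AddCommGroup M] [Module K M] [LieRingModule L M] [LieModule K L M]

/-- A pair of dual families for an invariant form `B`, spanning an ideal `J`. -/
structure IsDualPair (B : LinearMap.BilinForm K L) (J : LieIdeal K L) {n : ℕ}
    (e e' : Fin n → L) : Prop where
  mem : ∀ i, e i ∈ J
  mem' : ∀ i, e' i ∈ J
  apply_eq : ∀ i, B (e' i) (e i) = 1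
  expand : ∀ y ∈ J, y = ∑ j, B (e' j) y • e j
  expand' : ∀ y ∈ J, y = ∑ j, B y (e j) • e' j

lemma exists_isDualPair [FiniteDimensional K L] (B : LinearMap.BilinForm K L) (hB : B.IsSymm)
    (J : LieIdeal K L) (h : ∀ x ∈ J, (∀ y ∈ J, B x y = 0) → x = 0) :
    ∃ e e' : Fin (finrank K J) → L, IsDualPair B J e e' := by
  let B' : LinearMap.BilinForm K J := B.restrict J
  have hB' : B'.Nondegenerate := by
    have hl : LinearMap.SeparatingLeft B' := by
      rintro ⟨x, hx⟩ hxy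
      exact Subtype.ext (h x hx fun y hy ↦ hxy ⟨y, hy⟩)
    refine ⟨hl, fun y hy ↦ hl y fun x ↦ ?_⟩
    rw [← hy x]
    exact hB.eq _ _
  let b := finBasis K J
  let b' := B'.dualBasis hB' b
  have hbb : ∀ i j, B' (b' i) (b j) = if j = i then 1 else 0 := fun i j ↦
    LinearMap.BilinForm.apply_dualBasis_left hB' b i j
  refine ⟨fun i ↦ b i, fun i ↦ b' i, ⟨fun i ↦ (b i).2, fun i ↦ (b' i).2, fun i ↦ ?_, ?_, ?_⟩⟩
  · simpa using! hbb i i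
  · intro y hy
    have h1 : (⟨y, hy⟩ : J) = ∑ j, B' (b' j) ⟨y, hy⟩ • b j := by
      conv_lhs => rw [← b.sum_repr ⟨y, hy⟩]
      refine Finset.sum_congr rfl fun j _ ↦ ?_
      congr 1
      conv_rhs => rw [← b.sum_repr ⟨y, hy⟩, map_sum]
      simp [hbb]
    simpa using! congrArg (J.subtype) h1
  · intro y hy
    have h1 : (⟨y, hy⟩ : J) = ∑ j, B' ⟨y, hy⟩ (b j) • b' j := by
      conv_lhs => rw [← b'.sum_repr ⟨y, hy⟩]
      refine Finset.sum_congr rfl fun j _ ↦ ?_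
      congr 1
      conv_rhs => rw [← b'.sum_repr ⟨y, hy⟩, map_sum, LinearMap.sum_apply]
      simp [hbb]
    simpa using! congrArg (J.subtype) h1

variable {B : LinearMap.BilinForm K L} {J : LieIdeal K L} {n : ℕ} {e e' : Fin n → L}

/-- The tensor `∑ i, e i ⊗ e' i` of a dual pair is invariant. -/
lemma IsDualPair.sum_lie_eq_zero (h : IsDualPair B J e e') (hB : B.lieInvariant L)
    {N : Type*} [AddCommGroup N] [Module K N] (f : L →ₗ[K] L →ₗ[K] N) (x : L) :
    ∑ i, (f ⁅x, e i⁆ (e' i) + f (e i) ⁅x, e' i⁆) = 0 := by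
  have h1 : ∀ i, f ⁅x, e i⁆ (e' i) = ∑ j, B (e' j) ⁅x, e i⁆ • f (e j) (e' i) := fun i ↦ by
    conv_lhs => rw [h.expand _ (J.lie_mem (h.mem i))]
    simp
  have h2 : ∀ i, f (e i) ⁅x, e' i⁆ = ∑ j, B ⁅x, e' i⁆ (e j) • f (e i) (e' j) := fun i ↦ by
    conv_lhs => rw [h.expand' _ (J.lie_mem (h.mem' i))]
    simp
  rw [Finset.sum_add_distrib, Finset.sum_congr rfl fun i _ ↦ h1 i,
    Finset.sum_congr rfl fun i _ ↦ h2 i, Finset.sum_comm, ← Finset.sum_add_distrib]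
  refine Finset.sum_eq_zero fun i _ ↦ ?_
  rw [← Finset.sum_add_distrib]
  refine Finset.sum_eq_zero fun j _ ↦ ?_
  rw [hB x (e' i) (e j), neg_smul, add_neg_cancel]

variable (M) in
/-- The Casimir operator `∑ i, e i * e' i`. -/
def casimir (e e' : Fin n → L) : End K M := ∑ i, toEnd K L M (e i) * toEnd K L M (e' i)

lemma casimir_apply (m : M) : casimir (K := K) M e e' m = ∑ i, ⁅e i, ⁅e' i, m⁆⁆ := by
  simp [casimir]

lemma IsDualPair.lie_casimir (h : IsDualPair B J e e') (hB : B.lieInvariant L)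
    (x : L) (m : M) :
    ⁅x, casimir (K := K) M e e' m⁆ = casimir (K := K) M e e' ⁅x, m⁆ := by
  have h0 := h.sum_lie_eq_zero hB (N := M)
    (LinearMap.mk₂ K (fun a b ↦ ⁅a, ⁅b, m⁆⁆) (by simp) (by simp) (by simp) (by simp)) x
  simp only [LinearMap.mk₂_apply] at h0
  rw [casimir_apply, casimir_apply, ← sub_eq_zero, ← h0, lie_sum, ← Finset.sum_sub_distrib]
  refine Finset.sum_congr rfl fun i _ ↦ ?_
  rw [leibniz_lie x (e i), leibniz_lie x (e' i)]
  simp only [lie_add]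
  abel

/-- The composition of a cocycle with the Casimir operator is a coboundary. -/
lemma IsDualPair.casimir_cocycle (h : IsDualPair B J e e') (hB : B.lieInvariant L)
    (c : L →ₗ[K] M) (hc : ∀ x y, c ⁅x, y⁆ = ⁅x, c y⁆ - ⁅y, c x⁆) (x : L) :
    casimir (K := K) M e e' (c x) = ⁅x, ∑ i, ⁅e i, c (e' i)⁆⁆ := by
  have h0 := h.sum_lie_eq_zero hB (N := M)
    (LinearMap.mk₂ K (fun a b ↦ ⁅a, c b⁆) (by simp) (by simp) (by simp) (by simp)) x
  simp only [LinearMap.mk₂_apply] at h0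
  rw [← sub_eq_zero, ← neg_eq_zero, ← h0, casimir_apply, lie_sum, ← Finset.sum_sub_distrib,
    ← Finset.sum_neg_distrib]
  refine Finset.sum_congr rfl fun i _ ↦ ?_
  rw [leibniz_lie x (e i), hc x]
  simp only [lie_sub]
  abel

/-- Each summand has trace `B (e' i) (e i) = 1`. In characteristic zero this keeps the Casimir
operator from vanishing when `J ≠ 0`. -/
lemma IsDualPair.trace_casimir [FiniteDimensional K M]
    (h : IsDualPair (traceForm K L M) J e e') :
    LinearMap.trace K M (casimir (K := K) M e e') = n := by
  have : ∀ i, LinearMap.trace K M (toEnd K L M (e i) * toEnd K L M (e' i)) = 1 := fun i ↦ by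
    rw [← h.apply_eq i, traceForm_comm, traceForm_apply_apply]
    rfl
  simp [casimir, this]

/-- Over a nontrivial irreducible module of a semisimple Lie algebra, the cohomology vanishes. -/
lemma exists_eq_lie_of_cocycle_of_forall_submodule [CharZero K] [FiniteDimensional K L]
    [IsSemisimple K L] [FiniteDimensional K M]
    (hM : ∀ N : LieSubmodule K L M, N = ⊥ ∨ N = ⊤)
    (c : L →ₗ[K] M) (hc : ∀ x y, c ⁅x, y⁆ = ⁅x, c y⁆ - ⁅y, c x⁆) : ∃ m, ∀ x, c x = ⁅x, m⁆ := by
  have hB := traceForm_lieInvariant K L M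
  have hs := traceForm_isSymm K L M
  -- The trace form may be degenerate: `I` is its radical, and it is nondegenerate on a
  -- complementary ideal `J`, which supplies the Casimir operator.
  let I : LieIdeal K L := InvariantForm.orthogonal (traceForm K L M) hB (⊤ : LieIdeal K L)
  have hI : ∀ x ∈ I, ∀ y, traceForm K L M x y = 0 := fun x hx y ↦ by
    rw [traceForm_comm]
    exact (InvariantForm.mem_orthogonal _ hB _ _).mp hx y trivial
  obtain ⟨J, hJ⟩ := exists_isCompl I
  have hJnd : ∀ x ∈ J, (∀ y ∈ J, traceForm K L M x y = 0) → x = 0 := by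
    intro x hx hxy
    have : x ∈ I ⊓ J := by
      refine ⟨(InvariantForm.mem_orthogonal _ hB _ _).mpr fun y _ ↦ ?_, hx⟩
      have hy : y ∈ I ⊔ J := by rw [hJ.sup_eq_top]; trivial
      obtain ⟨a, ha, b, hb, rfl⟩ := (LieSubmodule.mem_sup _ _ _).mp hy
      rw [map_add, LinearMap.add_apply, hI a ha, traceForm_comm, hxy b hb, add_zero]
    rwa [hJ.inf_eq_bot] at this
  obtain ⟨e, e', he⟩ := exists_isDualPair _ ⟨hs.1⟩ J hJnd
  by_cases hr : finrank K J = 0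
  · have hJ0 : J = ⊥ := by
      rw [← LieSubmodule.toSubmodule_eq_bot]
      exact Submodule.finrank_eq_zero.mp hr
    have hItop : I = ⊤ := by simpa [hJ0] using hJ.sup_eq_top
    have htriv : ∀ (x : L) (m : M), ⁅x, m⁆ = 0 := fun x m ↦
      IsSemisimple.lie_eq_zero_of_traceForm_eq_zero (⊤ : LieIdeal K L)
        (fun a _ b _ ↦ hI a (hItop ▸ trivial) b) trivial m
    refine ⟨0, fun x ↦ ?_⟩
    have hx := IsSemisimple.mem_span_lie (⊤ : LieIdeal K L) (x := x) trivial
    rw [lie_zero, ← LinearMap.mem_ker]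
    refine Submodule.span_le.mpr ?_ hx
    rintro _ ⟨a, -, b, -, rfl⟩
    simp [hc, htriv]
  · let Ω := casimir (K := K) M e e'
    let N : LieSubmodule K L M :=
      { LinearMap.ker Ω with
        lie_mem := fun {x m} hm ↦ by
          change Ω ⁅x, m⁆ = 0
          rw [← he.lie_casimir hB, show casimir (K := K) M e e' m = 0 from hm, lie_zero] }
    -- Schur's argument: the kernel is a submodule, and it is not everything because the trace of
    -- `Ω` is `dim J ≠ 0`.
    have hN : LinearMap.ker Ω = ⊥ := by
      rcases hM N with h | h
      · exact (LieSubmodule.toSubmodule_eq_bot N).mpr h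
      · have h0 : Ω = 0 := LinearMap.ker_eq_top.mp ((LieSubmodule.toSubmodule_eq_top N).mpr h)
        have ht := he.trace_casimir
        rw [show casimir (K := K) M e e' = 0 from h0, map_zero] at ht
        exact absurd (by exact_mod_cast ht.symm) hr
    obtain ⟨m, hm⟩ := LinearMap.injective_iff_surjective.mp (LinearMap.ker_eq_bot.mp hN)
      (∑ i, ⁅e i, c (e' i)⁆)
    refine ⟨m, fun x ↦ LinearMap.ker_eq_bot.mp hN ?_⟩
    rw [show Ω ⁅x, m⁆ = ⁅x, Ω m⁆ from (he.lie_casimir hB x m).symm, hm]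
    exact he.casimir_cocycle hB c hc x

/-- **Whitehead's first lemma**: every 1-cocycle of a semisimple Lie algebra with values in a
finite-dimensional module is a coboundary. -/
theorem exists_eq_lie_of_cocycle {K L : Type*} {M : Type*} [Field K] [CharZero K] [LieRing L]
    [LieAlgebra K L] [FiniteDimensional K L] [IsSemisimple K L]
    [AddCommGroup M] [Module K M] [LieRingModule L M] [LieModule K L M] [FiniteDimensional K M]
    (c : L →ₗ[K] M) (hc : ∀ x y, c ⁅x, y⁆ = ⁅x, c y⁆ - ⁅y, c x⁆) : ∃ m, ∀ x, c x = ⁅x, m⁆ := by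
  induction hd : finrank K M using Nat.strong_induction_on generalizing M with
  | _ d ih =>
    by_cases hM : ∀ N : LieSubmodule K L M, N = ⊥ ∨ N = ⊤
    · exact exists_eq_lie_of_cocycle_of_forall_submodule hM c hc
    push Not at hM
    obtain ⟨N, hN0, hN1⟩ := hM
    have hsum := Submodule.finrank_quotient_add_finrank (N : Submodule K M)
    have hpos : 0 < finrank K N := by
      rw [Nat.pos_iff_ne_zero]
      exact fun h ↦ hN0 ((LieSubmodule.toSubmodule_eq_bot N).mp (Submodule.finrank_eq_zero.mp h))
    have hlt : finrank K N < finrank K M := by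
      refine Submodule.finrank_lt fun h ↦ hN1 ((LieSubmodule.toSubmodule_eq_top N).mp h)
    obtain ⟨m', hm'⟩ := ih (finrank K (M ⧸ N)) (by
        change finrank K (M ⧸ (N : Submodule K M)) < d
        change _ + finrank K N = _ at hsum
        omega)
      ((LieSubmodule.Quotient.mk' N : M →ₗ[K] M ⧸ N) ∘ₗ c) (fun x y ↦ by
        simp only [LinearMap.comp_apply, hc, map_sub]
        rfl) rfl
    obtain ⟨m, rfl⟩ := LieSubmodule.Quotient.surjective_mk' N m'
    have hmem : ∀ x, c x - ⁅x, m⁆ ∈ N := fun x ↦ by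
      rw [← LieSubmodule.Quotient.mk_eq_zero, map_sub, sub_eq_zero, LieModuleHom.map_lie]
      exact hm' x
    -- Subtracting the coboundary of a lift of the solution in `M ⧸ N` leaves a cocycle with values
    -- in `N`.
    let c' : L →ₗ[K] M := c - LinearMap.flip (toEnd K L M : L →ₗ[K] M →ₗ[K] M) m
    have hc' : ∀ x, c' x = c x - ⁅x, m⁆ := fun x ↦ rfl
    let c'' : L →ₗ[K] N := c'.codRestrict (N : Submodule K M) hmem
    have hc'' : ∀ x y, c'' ⁅x, y⁆ = ⁅x, c'' y⁆ - ⁅y, c'' x⁆ := fun x y ↦ Subtype.ext (by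
      change c' ⁅x, y⁆ = ⁅x, c' y⁆ - ⁅y, c' x⁆
      simp only [hc', hc, lie_sub, lie_lie]
      abel)
    obtain ⟨u, hu⟩ := ih (finrank K N) (hd ▸ hlt) c'' hc'' rfl
    refine ⟨m + u, fun x ↦ ?_⟩
    have := congrArg (Subtype.val) (hu x)
    change c' x = ⁅x, (u : M)⁆ at this
    rw [lie_add, ← this, hc']
    abel

/-- Whitehead's first lemma for a finite-dimensional subquotient of a module. -/
theorem exists_sub_lie_mem_of_cocycle [CharZero K] [FiniteDimensional K L] [IsSemisimple K L]
    (A B : LieSubmodule K L M)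
    (hfin : FiniteDimensional K (A ⧸ Submodule.submoduleOf (B : Submodule K M) A))
    (c : L →ₗ[K] M) (hcA : ∀ x, c x ∈ A)
    (hc : ∀ x y, c ⁅x, y⁆ - (⁅x, c y⁆ - ⁅y, c x⁆) ∈ B) :
    ∃ m ∈ A, ∀ x, c x - ⁅x, m⁆ ∈ B := by
  let B' : LieSubmodule K L A := B.comap A.incl
  have : FiniteDimensional K (A ⧸ B') := hfin
  let c' : L →ₗ[K] A := c.codRestrict (A : Submodule K M) hcA
  obtain ⟨m', hm'⟩ := exists_eq_lie_of_cocycle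
    ((LieSubmodule.Quotient.mk' B' : A →ₗ[K] A ⧸ B') ∘ₗ c') (fun x y ↦ by
      have : c' ⁅x, y⁆ - (⁅x, c' y⁆ - ⁅y, c' x⁆) ∈ B' := hc x y
      rw [← LieSubmodule.Quotient.mk_eq_zero, map_sub, sub_eq_zero, map_sub,
        LieModuleHom.map_lie, LieModuleHom.map_lie] at this
      exact this)
  obtain ⟨m, rfl⟩ := LieSubmodule.Quotient.surjective_mk' B' m'
  refine ⟨m, m.2, fun x ↦ ?_⟩
  have : c' x - ⁅x, m⁆ ∈ B' := by
    rw [← LieSubmodule.Quotient.mk_eq_zero, map_sub, sub_eq_zero, LieModuleHom.map_lie]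
    exact hm' x
  exact this

end LieModule

/-! ### Conjugacy of homomorphisms into a complete filtered Lie algebra -/

namespace LieAlgebra

open scoped Nat

variable {K L S : Type*} [Field K] [LieRing L] [LieAlgebra K L] [LieRing S] [LieAlgebra K S]

variable (K) in
/-- The partial sum `∑ n < N, (ad z) ^ n / n!` of the exponential series of `ad z`. -/
def expAdPartial (N : ℕ) (z : S) : S →ₗ[K] S :=
  ∑ n ∈ Finset.range N, (n ! : K)⁻¹ • ((ad K S z) ^ n)

lemma expAdPartial_apply (N : ℕ) (z x : S) :
    expAdPartial K N z x = ∑ n ∈ Finset.range N, (n ! : K)⁻¹ • ((ad K S z) ^ n) x := by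
  simp [expAdPartial]

lemma expAdPartial_succ (N : ℕ) (z x : S) :
    expAdPartial K (N + 1) z x = expAdPartial K N z x + (N ! : K)⁻¹ • ((ad K S z) ^ N) x := by
  rw [expAdPartial_apply, expAdPartial_apply, Finset.sum_range_succ]

lemma ad_pow_apply_lie (z x y : S) (n : ℕ) :
    ((ad K S z) ^ n) ⁅x, y⁆ = ∑ p ∈ Finset.HasAntidiagonal.antidiagonal n,
      n.choose p.1 • ⁅((ad K S z) ^ p.1) x, ((ad K S z) ^ p.2) y⁆ := by
  have := LieDerivation.iterate_apply_lie (LieDerivation.ad K S z) n x y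
  have hcoe : ⇑(LieDerivation.ad K S z) = ⇑(ad K S z) := by
    ext w
    simp
  rw [hcoe] at this
  simpa only [Module.End.pow_apply] using this

/-- A decreasing filtration `S = G 0 ≥ G 1 ≥ ⋯` of a Lie algebra, compatible with the bracket. -/
structure IsFiltration (G : ℕ → Submodule K S) : Prop where
  zero : G 0 = ⊤
  anti : Antitone G
  lie_mem : ∀ {i j x y}, x ∈ G i → y ∈ G j → ⁅x, y⁆ ∈ G (i + j)

namespace IsFiltration

variable {G : ℕ → Submodule K S} (hG : IsFiltration G)
include hG

lemma mem_zero (x : S) : x ∈ G 0 := hG.zero ▸ trivial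

lemma ad_pow_mem {z : S} (hz : z ∈ G 1) (x : S) (n : ℕ) : ((ad K S z) ^ n) x ∈ G n := by
  induction n with
  | zero => exact hG.mem_zero _
  | succ n ih =>
    rw [pow_succ', add_comm]
    exact hG.lie_mem hz ih

/-- Truncated form of the fact that `exp (ad z)` preserves brackets. The left bracket sums over the
square `i, j < N`; by Leibniz the other term is the triangle `i + j < N`, and the remaining terms
lie in `G (i + j) ≤ G N`. -/
lemma lie_expAdPartial_sub_mem [CharZero K] {z : S} (hz : z ∈ G 1) (N : ℕ) (x y : S) :
    ⁅expAdPartial K N z x, expAdPartial K N z y⁆ - expAdPartial K N z ⁅x, y⁆ ∈ G N := by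
  let f : ℕ × ℕ → S := fun p ↦ (((p.1)! : K)⁻¹ * ((p.2)! : K)⁻¹) •
    ⁅((ad K S z) ^ p.1) x, ((ad K S z) ^ p.2) y⁆
  have h1 : ⁅expAdPartial K N z x, expAdPartial K N z y⁆ =
      ∑ p ∈ Finset.range N ×ˢ Finset.range N, f p := by
    simp only [expAdPartial_apply, sum_lie, lie_sum, Finset.sum_product,
      smul_lie, lie_smul, f]
    simp only [mul_smul, Finset.smul_sum]
    rw [Finset.sum_comm]
    refine Finset.sum_congr rfl fun i _ ↦ Finset.sum_congr rfl fun j _ ↦ smul_comm _ _ _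
  have h2 : expAdPartial K N z ⁅x, y⁆ =
      ∑ p ∈ Finset.range N ×ˢ Finset.range N with p.1 + p.2 < N, f p := by
    rw [expAdPartial_apply, ← Finset.sum_fiberwise_of_maps_to (t := Finset.range N)
      (g := fun p : ℕ × ℕ ↦ p.1 + p.2) (by simp)]
    refine Finset.sum_congr rfl fun n hn ↦ ?_
    have : {p ∈ {p ∈ Finset.range N ×ˢ Finset.range N | p.1 + p.2 < N} | p.1 + p.2 = n} =
        Finset.HasAntidiagonal.antidiagonal n := by
      ext p
      simp only [Finset.mem_range] at hn
      simp only [Finset.mem_filter, Finset.mem_product, Finset.mem_range,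
        Finset.HasAntidiagonal.mem_antidiagonal]
      omega
    rw [this, ad_pow_apply_lie, Finset.smul_sum]
    refine Finset.sum_congr rfl fun p hp ↦ ?_
    obtain ⟨i, j⟩ := p
    obtain rfl : i + j = n := by simpa using hp
    simp only [f, ← Nat.cast_smul_eq_nsmul K, smul_smul]
    congr 1
    have h0 : ((i + j)! : K) ≠ 0 := by exact_mod_cast (i + j).factorial_ne_zero
    have hi : (i ! : K) ≠ 0 := by exact_mod_cast i.factorial_ne_zero
    have hj : (j ! : K) ≠ 0 := by exact_mod_cast j.factorial_ne_zero
    have hch : ((i + j).choose i : K) * i ! * j ! = (i + j)! := by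
      have := Nat.choose_mul_factorial_mul_factorial (Nat.le_add_right i j)
      rw [Nat.add_sub_cancel_left] at this
      exact_mod_cast this
    field_simp
    linear_combination hch
  rw [h1, h2, ← Finset.sum_filter_add_sum_filter_not (Finset.range N ×ˢ Finset.range N)
    (fun p ↦ p.1 + p.2 < N), add_sub_cancel_left]
  refine Submodule.sum_mem _ fun p hp ↦ Submodule.smul_mem _ _ ?_
  exact hG.anti (not_lt.mp (Finset.mem_filter.mp hp).2)
    (hG.lie_mem (hG.ad_pow_mem hz x p.1) (hG.ad_pow_mem hz y p.2))

lemma expAdPartial_succ_sub_mem {z : S} (hz : z ∈ G 1) (N : ℕ) (x : S) :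
    expAdPartial K (N + 1) z x - expAdPartial K N z x ∈ G N := by
  rw [expAdPartial_succ, add_sub_cancel_left]
  exact Submodule.smul_mem _ _ (hG.ad_pow_mem hz x N)

lemma ad_pow_add_sub_mem {z d : S} {k : ℕ} (hz : z ∈ G 1) (hd : d ∈ G (k + 1)) (x : S) (n : ℕ) :
    ((ad K S (z + d)) ^ n) x - ((ad K S z) ^ n) x ∈ G (k + 1) := by
  have hzd : z + d ∈ G 1 := add_mem hz (hG.anti (by omega) hd)
  induction n with
  | zero => simp
  | succ n ih =>
    have : ((ad K S (z + d)) ^ (n + 1)) x - ((ad K S z) ^ (n + 1)) x =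
        ⁅z + d, ((ad K S (z + d)) ^ n) x - ((ad K S z) ^ n) x⁆ + ⁅d, ((ad K S z) ^ n) x⁆ := by
      simp only [pow_succ', Module.End.mul_apply, ad_apply, lie_sub, add_lie]
      abel
    rw [this]
    exact add_mem (hG.anti (by omega) (hG.lie_mem hzd ih))
      (hG.anti (by omega) (hG.lie_mem hd (hG.mem_zero _)))

/-- Every word in the expanded difference contains a `d` and at least one further letter in `G 1`,
which gains one degree. So only the linear term of the exponential sees `d` modulo `G (k + 2)`. -/
lemma ad_pow_add_sub_mem' {z d : S} {k : ℕ} (hz : z ∈ G 1) (hd : d ∈ G (k + 1)) (x : S) (n : ℕ) :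
    ((ad K S (z + d)) ^ (n + 2)) x - ((ad K S z) ^ (n + 2)) x ∈ G (k + 2) := by
  have hzd : z + d ∈ G 1 := add_mem hz (hG.anti (by omega) hd)
  have : ((ad K S (z + d)) ^ (n + 2)) x - ((ad K S z) ^ (n + 2)) x =
      ⁅z + d, ((ad K S (z + d)) ^ (n + 1)) x - ((ad K S z) ^ (n + 1)) x⁆
        + ⁅d, ((ad K S z) ^ (n + 1)) x⁆ := by
    simp only [pow_succ' _ (n + 1), Module.End.mul_apply, ad_apply, lie_sub, add_lie]
    abel
  rw [this]
  exact add_mem (hG.anti (by omega) (hG.lie_mem hzd (hG.ad_pow_add_sub_mem hz hd x (n + 1))))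
    (hG.anti (by omega) (hG.lie_mem hd (hG.ad_pow_mem hz x (n + 1))))

lemma expAdPartial_add_sub_mem {z d : S} {k : ℕ} (hz : z ∈ G 1) (hd : d ∈ G (k + 1)) (x : S)
    (N : ℕ) : expAdPartial K N (z + d) x - expAdPartial K N z x ∈ G (k + 1) := by
  rw [expAdPartial_apply, expAdPartial_apply, ← Finset.sum_sub_distrib]
  refine Submodule.sum_mem _ fun n _ ↦ ?_
  rw [← smul_sub]
  exact Submodule.smul_mem _ _ (hG.ad_pow_add_sub_mem hz hd x n)

lemma expAdPartial_add_sub_sub_mem {z d : S} {k : ℕ} (hz : z ∈ G 1) (hd : d ∈ G (k + 1)) (x : S)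
    (N : ℕ) : expAdPartial K (N + 2) (z + d) x - expAdPartial K (N + 2) z x - ⁅d, x⁆
      ∈ G (k + 2) := by
  have : expAdPartial K (N + 2) (z + d) x - expAdPartial K (N + 2) z x - ⁅d, x⁆ =
      ∑ n ∈ Finset.range N, ((n + 2)! : K)⁻¹ •
        (((ad K S (z + d)) ^ (n + 2)) x - ((ad K S z) ^ (n + 2)) x) := by
    simp only [expAdPartial_apply, Finset.sum_range_succ' _ (N + 1), Finset.sum_range_succ' _ N,
      smul_sub, Finset.sum_sub_distrib]
    simp
    abel
  rw [this]
  exact Submodule.sum_mem _ fun n _ ↦ Submodule.smul_mem _ _ (hG.ad_pow_add_sub_mem' hz hd x n)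

variable [CharZero K] [FiniteDimensional K L] [IsSemisimple K L]

/-- One step of successive approximation: a solution modulo `G (k + 1)` of the conjugation
problem is corrected by an element of `G (k + 1)` to a solution modulo `G (k + 2)`. -/
lemma exists_correction
    (hfin : ∀ k, FiniteDimensional K (G k ⧸ (G (k + 1)).submoduleOf (G k)))
    (s t : L →ₗ⁅K⁆ S) (hst : ∀ p, s p - t p ∈ G 1) {k : ℕ} {z : S} (hz : z ∈ G 1)
    (h : ∀ p, expAdPartial K (k + 1) z (s p) - t p ∈ G (k + 1)) :
    ∃ d ∈ G (k + 1), ∀ p, expAdPartial K (k + 2) (z + d) (s p) - t p ∈ G (k + 2) := by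
  -- `L` acts on `S` through `ad ∘ t`; as `t p ∈ G 0`, each `G i` is a submodule.
  let _ : LieRingModule L S := LieRingModule.compLieHom S t
  have _ : LieModule K L S := LieModule.compLieHom S t
  have hlie : ∀ (p : L) (x : S), ⁅p, x⁆ = ⁅t p, x⁆ := fun _ _ ↦ rfl
  let A (i : ℕ) : LieSubmodule K L S :=
    { G i with
      lie_mem := fun {p x} hx ↦ by
        simpa [hlie] using! hG.lie_mem (hG.mem_zero (t p)) hx }
  let c : L →ₗ[K] S := expAdPartial K (k + 2) z ∘ₗ (s : L →ₗ[K] S) - (t : L →ₗ[K] S)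
  have hcp : ∀ p, expAdPartial K (k + 2) z (s p) = t p + c p := fun p ↦ by simp [c]
  have hc : ∀ p, c p ∈ G (k + 1) := fun p ↦ by
    have := add_mem (hG.expAdPartial_succ_sub_mem hz (k + 1) (s p)) (h p)
    rwa [sub_add_sub_cancel] at this
  -- The error `c` is a cocycle modulo `G (k + 2)`: both the quadratic term `⁅c p, c q⁆` and the
  -- failure of the truncated exponential to preserve brackets lie there.
  obtain ⟨d, hd, hdc⟩ := LieModule.exists_sub_lie_mem_of_cocycle (A (k + 1)) (A (k + 2))
    (hfin (k + 1)) c hc (fun p q ↦ by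
      have h1 := hG.lie_expAdPartial_sub_mem hz (k + 2) (s p) (s q)
      rw [← LieHom.map_lie, hcp, hcp, hcp, LieHom.map_lie] at h1
      have h2 : ⁅c p, c q⁆ ∈ G (k + 2) := hG.anti (by omega) (hG.lie_mem (hc p) (hc q))
      have h3 := sub_mem h2 h1
      change _ ∈ G (k + 2)
      convert h3 using 1
      rw [hlie, hlie, ← lie_skew (t q) (c p)]
      simp only [add_lie, lie_add]
      abel)
  refine ⟨d, hd, fun p ↦ ?_⟩
  have h1 := hG.expAdPartial_add_sub_sub_mem hz hd (s p) k
  -- Modulo `G (k + 2)`, adding `d` changes the error by `⁅d, s p⁆ ≡ ⁅d, t p⁆ = -⁅t p, d⁆`, which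
  -- cancels `c p`.
  have h2 : ⁅d, s p - t p⁆ ∈ G (k + 1 + 1) := hG.lie_mem (i := k + 1) hd (hst p)
  have h3 : c p - ⁅t p, d⁆ ∈ G (k + 2) := hdc p
  have h4 := add_mem (add_mem h1 h2) h3
  convert h4 using 1
  rw [hcp, lie_sub, ← lie_skew d (t p)]
  abel

/-- Two homomorphisms from a semisimple Lie algebra to a complete filtered Lie algebra `S` which
agree modulo `G 1` are conjugate by the exponential of some `ad z`, `z ∈ G 1`. -/
theorem exists_expAdPartial_sub_mem
    (hfin : ∀ k, FiniteDimensional K (G k ⧸ (G (k + 1)).submoduleOf (G k)))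
    (hcomplete : ∀ u : ℕ → S, (∀ k, u (k + 1) - u k ∈ G (k + 1)) → ∃ z, ∀ k, z - u k ∈ G (k + 1))
    (s t : L →ₗ⁅K⁆ S) (hst : ∀ p, s p - t p ∈ G 1) :
    ∃ z ∈ G 1, ∀ N p, expAdPartial K (N + 1) z (s p) - t p ∈ G (N + 1) := by
  have hstep : ∀ (k : ℕ) (z : S), ∃ d : S, z ∈ G 1 →
      (∀ p, expAdPartial K (k + 1) z (s p) - t p ∈ G (k + 1)) →
      d ∈ G (k + 1) ∧ ∀ p, expAdPartial K (k + 2) (z + d) (s p) - t p ∈ G (k + 2) := by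
    intro k z
    by_cases h : z ∈ G 1 ∧ ∀ p, expAdPartial K (k + 1) z (s p) - t p ∈ G (k + 1)
    · obtain ⟨d, hd, hd'⟩ := hG.exists_correction hfin s t hst h.1 h.2
      exact ⟨d, fun _ _ ↦ ⟨hd, hd'⟩⟩
    -- A junk value, so that `choose` yields a correction defined for all `k` and `z`.
    · exact ⟨0, fun h1 h2 ↦ absurd ⟨h1, h2⟩ h⟩
  choose δ hδ using hstep
  let u : ℕ → S := fun n ↦ Nat.rec 0 (fun k z ↦ z + δ k z) n
  have hu : ∀ k, u (k + 1) = u k + δ k (u k) := fun k ↦ rfl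
  have hmain : ∀ k, u k ∈ G 1 ∧ ∀ p, expAdPartial K (k + 1) (u k) (s p) - t p ∈ G (k + 1) := by
    intro k
    induction k with
    | zero => exact ⟨zero_mem _, fun p ↦ by simpa [expAdPartial_apply] using hst p⟩
    | succ k ih =>
      obtain ⟨h1, h2⟩ := hδ k (u k) ih.1 ih.2
      rw [hu]
      exact ⟨add_mem ih.1 (hG.anti (by omega) h1), h2⟩
  obtain ⟨z, hz⟩ := hcomplete u fun k ↦ by
    rw [hu, add_sub_cancel_left]
    exact (hδ k (u k) (hmain k).1 (hmain k).2).1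
  refine ⟨z, by simpa [u] using hz 0, fun N p ↦ ?_⟩
  have h := add_mem (hG.expAdPartial_add_sub_mem (hmain N).1 (hz N) (s p) (N + 1)) ((hmain N).2 p)
  rwa [add_sub_cancel, sub_add_sub_cancel] at h

end IsFiltration

end LieAlgebra

/-! ### Formal power series, formal vector fields and jets -/

noncomputable section

namespace MvPowerSeries

variable {ι R : Type*} [CommRing R]

/-- A power series without constant term over finitely many variables is a combination of the
variables; the coefficients can be chosen of order at least `k` if the series has order at
least `k + 1`. -/
lemma exists_eq_sum_X_mul [Fintype ι] {k : ℕ} (f : MvPowerSeries ι R)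
    (hf : ∀ m : ι →₀ ℕ, m.degree < k + 1 → coeff m f = 0) :
    ∃ g : ι → MvPowerSeries ι R, (∀ i, ∀ m : ι →₀ ℕ, m.degree < k → coeff m (g i) = 0) ∧
      f = ∑ i, X i * g i := by
  classical
  rcases isEmpty_or_nonempty ι with hι | hι
  · refine ⟨0, by simp, ?_⟩
    ext m
    rw [hf m (by simp [Subsingleton.elim m 0])]
    simp
  -- Assign to each nonconstant monomial one variable dividing it, so that its coefficient is
  -- counted in exactly one `g i`.
  have hpick : ∀ m : ι →₀ ℕ, m ≠ 0 → ∃ i, m i ≠ 0 := fun m hm ↦ by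
    by_contra! h
    exact hm (Finsupp.ext h)
  choose! pick hpick using hpick
  let g : ι → MvPowerSeries ι R := fun i n ↦
    if pick (n + Finsupp.single i 1) = i then coeff (n + Finsupp.single i 1) f else 0
  have hg : ∀ i n, coeff n (g i) =
      if pick (n + Finsupp.single i 1) = i then coeff (n + Finsupp.single i 1) f else 0 :=
    fun i n ↦ rfl
  refine ⟨g, fun i m hm ↦ ?_, ?_⟩
  · rw [hg]
    split_ifs
    · exact hf _ (by rw [map_add, Finsupp.degree_single]; omega)
    · rfl
  · ext m
    have hterm : ∀ j, coeff m (X j * g j) = if m j ≠ 0 ∧ pick m = j then coeff m f else 0 := by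
      intro j
      by_cases hj : m j ≠ 0
      · have hle : Finsupp.single j 1 ≤ m := by
          rw [Finsupp.single_le_iff]
          omega
        obtain ⟨n, rfl⟩ := exists_add_of_le hle
        rw [X, coeff_add_monomial_mul, one_mul, hg, add_comm n]
        simp
      · rw [X, coeff_monomial_mul, if_neg, if_neg (by tauto)]
        rw [Finsupp.single_le_iff]
        omega
    rw [map_sum, Finset.sum_congr rfl fun j _ ↦ hterm j]
    by_cases hm : m = 0
    · subst hm
      simp [hf 0 (by simp)]
    · rw [Finset.sum_eq_single (pick m) (fun j _ hj ↦ if_neg fun h ↦ hj h.2.symm) (by simp),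
        if_pos ⟨hpick m hm, rfl⟩]

end MvPowerSeries

namespace JetAlgebra

variable {ι : Type*} {𝔨 𝔭 : Type*} [LieRing 𝔨] [LieAlgebra ℝ 𝔨] [LieRing 𝔭] [LieAlgebra ℝ 𝔭]

lemma coeff_zero_vectorField (v : VectorFields ι) (f : FormalSeries ι) :
    MvPowerSeries.coeff 0 (v.1 f) = 0 := by
  have h := v.2 (f - algebraMap ℝ _ (MvPowerSeries.constantCoeff f))
    (by rw [MvPowerSeries.algebraMap_apply]; simp)
  rw [map_sub, Derivation.map_algebraMap, sub_zero] at h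
  exact h

/-- Vector fields vanishing at the origin do not lower the order of a power series. -/
lemma coeff_vectorField_eq_zero [Finite ι] (v : VectorFields ι) {k : ℕ} (f : FormalSeries ι)
    (hf : ∀ m : ι →₀ ℕ, m.degree < k → MvPowerSeries.coeff m f = 0) (m : ι →₀ ℕ)
    (hm : m.degree < k) : MvPowerSeries.coeff m (v.1 f) = 0 := by
  classical
  have := Fintype.ofFinite ι
  have hprod : ∀ (a b : ℕ) (f g : FormalSeries ι),
      (∀ m : ι →₀ ℕ, m.degree < a → MvPowerSeries.coeff m f = 0) →
      (∀ m : ι →₀ ℕ, m.degree < b → MvPowerSeries.coeff m g = 0) →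
      ∀ m : ι →₀ ℕ, m.degree < a + b → MvPowerSeries.coeff m (f * g) = 0 := by
    intro a b f g hf hg m hm
    rw [MvPowerSeries.coeff_mul]
    refine Finset.sum_eq_zero fun p hp ↦ ?_
    rw [Finset.HasAntidiagonal.mem_antidiagonal] at hp
    rw [← hp, map_add] at hm
    by_cases h : p.1.degree < a
    · rw [hf _ h, zero_mul]
    · rw [hg _ (by omega), mul_zero]
  have hone : ∀ g : FormalSeries ι, MvPowerSeries.coeff 0 g = 0 →
      ∀ m : ι →₀ ℕ, m.degree < 1 → MvPowerSeries.coeff m g = 0 := by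
    intro g hg m hm
    rwa [(Finsupp.degree_eq_zero_iff m).mp (by omega)]
  induction k generalizing f m with
  | zero => omega
  | succ k ih =>
    -- The Leibniz rule on the finite sum `∑ x_i g_i` replaces any continuity of the derivation:
    -- `g_i` has order at least `k`, and `D x_i` has no constant term.
    obtain ⟨g, hg, rfl⟩ := MvPowerSeries.exists_eq_sum_X_mul f hf
    rw [map_sum, map_sum]
    refine Finset.sum_eq_zero fun i _ ↦ ?_
    rw [Derivation.leibniz, map_add, smul_eq_mul, smul_eq_mul]
    rw [hprod 1 k _ _ (hone _ (by simp)) (ih _ (hg i)) m (by omega),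
      hprod k 1 _ _ (hg i) (hone _ (coeff_zero_vectorField v _)) m (by omega), add_zero]

@[simp] lemma coeffAt_tmul (m : ι →₀ ℕ) (f : FormalSeries ι) (X : 𝔨) :
    coeffAt m (f ⊗ₜ[ℝ] X) = MvPowerSeries.coeff m f • X := by
  simp [coeffAt]

@[simp] lemma lieDeriv_tmul (v : VectorFields ι) (f : FormalSeries ι) (X : 𝔨) :
    lieDeriv v (f ⊗ₜ[ℝ] X) = v.1 f ⊗ₜ[ℝ] X := by
  simp [lieDeriv]

@[simp] lemma lieDeriv_const (v : VectorFields ι) (X : 𝔨) : lieDeriv v (const X) = 0 := by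
  simp [const]

@[simp] lemma ev₀_const (X : 𝔨) : ev₀ (const X : Jet ι 𝔨) = X := by
  simp [ev₀, const]

lemma const_lie (X Y : 𝔨) : (const ⁅X, Y⁆ : Jet ι 𝔨) = ⁅(const X : Jet ι 𝔨), (const Y : Jet ι 𝔨)⁆ := by
  simp [const]

lemma jet_add_lie (x y z : Jet ι 𝔨) : ⁅x + y, z⁆ = ⁅x, z⁆ + ⁅y, z⁆ := add_lie x y z

lemma jet_lie_add (x y z : Jet ι 𝔨) : ⁅x, y + z⁆ = ⁅x, y⁆ + ⁅x, z⁆ := lie_add x y z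

lemma jet_zero_lie (x : Jet ι 𝔨) : ⁅(0 : Jet ι 𝔨), x⁆ = 0 := zero_lie x

lemma jet_lie_zero (x : Jet ι 𝔨) : ⁅x, (0 : Jet ι 𝔨)⁆ = 0 := lie_zero x

open Finset.HasAntidiagonal in
lemma coeffAt_lie [DecidableEq ι] (m : ι →₀ ℕ) (x y : Jet ι 𝔨) :
    coeffAt m ⁅x, y⁆ = ∑ p ∈ antidiagonal m, ⁅coeffAt p.1 x, coeffAt p.2 y⁆ := by
  induction x using TensorProduct.induction_on with
  | zero => simp [jet_zero_lie]
  | add x x' hx hx' => simp [jet_add_lie, hx, hx', Finset.sum_add_distrib]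
  | tmul f X =>
    induction y using TensorProduct.induction_on with
    | zero => simp [jet_lie_zero]
    | add y y' hy hy' => simp only [jet_lie_add, map_add, hy, hy', _root_.lie_add, Finset.sum_add_distrib]
    | tmul g Y =>
      simp only [LieAlgebra.ExtendScalars.bracket_tmul, coeffAt_tmul, MvPowerSeries.coeff_mul,
        Finset.sum_smul, smul_lie, lie_smul, smul_smul]
      simp only [mul_comm]

lemma lieDeriv_lie (v : VectorFields ι) (x y : Jet ι 𝔨) :
    lieDeriv v ⁅x, y⁆ = ⁅x, lieDeriv v y⁆ + ⁅lieDeriv v x, y⁆ := by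
  induction x using TensorProduct.induction_on with
  | zero => simp [jet_zero_lie]
  | add x x' hx hx' => rw [jet_add_lie, map_add, hx, hx', map_add, jet_add_lie, jet_add_lie]; abel
  | tmul f X =>
    induction y using TensorProduct.induction_on with
    | zero => simp [jet_lie_zero]
    | add y y' hy hy' => rw [jet_lie_add, map_add, hy, hy', map_add, jet_lie_add, jet_lie_add]; abel
    | tmul g Y =>
      simp [TensorProduct.add_tmul, mul_comm]

lemma lieDeriv_commutator (v w : VectorFields ι) (x : Jet ι 𝔨) :
    lieDeriv ⁅v, w⁆ x = lieDeriv v (lieDeriv w x) - lieDeriv w (lieDeriv v x) := by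
  induction x using TensorProduct.induction_on with
  | zero => simp
  | add x x' hx hx' => simp only [map_add, hx, hx']; abel
  | tmul f X => simp [Derivation.commutator_apply, TensorProduct.sub_tmul]

lemma lieDeriv_add (v w : VectorFields ι) (x : Jet ι 𝔨) :
    lieDeriv (v + w) x = lieDeriv v x + lieDeriv w x := by
  simp [lieDeriv]

lemma lieDeriv_smul (r : ℝ) (v : VectorFields ι) (x : Jet ι 𝔨) :
    lieDeriv (r • v) x = r • lieDeriv v x := by
  simp [lieDeriv]

/-- The jets of order at least `k`. -/
def orderGE (ι 𝔨 : Type*) [LieRing 𝔨] [LieAlgebra ℝ 𝔨] (k : ℕ) : Submodule ℝ (Jet ι 𝔨) where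
  carrier := {x | ∀ m : ι →₀ ℕ, m.degree < k → coeffAt m x = 0}
  add_mem' hx hy m hm := by simp [hx m hm, hy m hm]
  zero_mem' m _ := by simp
  smul_mem' c x hx m hm := by simp [hx m hm]

lemma mem_orderGE_zero (x : Jet ι 𝔨) : x ∈ orderGE ι 𝔨 0 := fun _ hm ↦ by simp at hm

lemma orderGE_antitone : Antitone (orderGE ι 𝔨) :=
  fun _ _ h _ hx m hm ↦ hx m (hm.trans_le h)

lemma lie_mem_orderGE {i j : ℕ} {x y : Jet ι 𝔨} (hx : x ∈ orderGE ι 𝔨 i)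
    (hy : y ∈ orderGE ι 𝔨 j) : ⁅x, y⁆ ∈ orderGE ι 𝔨 (i + j) := by
  classical
  intro m hm
  rw [coeffAt_lie]
  refine Finset.sum_eq_zero fun p hp ↦ ?_
  rw [Finset.HasAntidiagonal.mem_antidiagonal] at hp
  rw [← hp, map_add] at hm
  by_cases h : p.1.degree < i
  · rw [hx _ h, zero_lie]
  · rw [hy _ (by omega), lie_zero]

lemma ev₀_lieDeriv (v : VectorFields ι) (x : Jet ι 𝔨) : ev₀ (lieDeriv v x) = 0 := by
  induction x using TensorProduct.induction_on with
  | zero => simp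
  | add x x' hx hx' => rw [map_add, map_add, hx, hx', add_zero]
  | tmul f X => rw [lieDeriv_tmul, ev₀, coeffAt_tmul, coeff_zero_vectorField, zero_smul]

lemma ev₀_lie (x y : Jet ι 𝔨) : ev₀ ⁅x, y⁆ = ⁅ev₀ x, ev₀ y⁆ := by
  classical
  rw [ev₀, coeffAt_lie]
  simp

lemma mem_orderGE_one {x : Jet ι 𝔨} : x ∈ orderGE ι 𝔨 1 ↔ ev₀ x = 0 := by
  refine ⟨fun h ↦ h 0 (by simp), fun h m hm ↦ ?_⟩
  rwa [(Finsupp.degree_eq_zero_iff m).mp (by omega)]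

/-- A series whose `n`-th term has order at least `n` converges to any element with the right
coefficients. -/
lemma hasSum_of_sub_mem {u : ℕ → Jet ι 𝔨} (hu : ∀ n, u n ∈ orderGE ι 𝔨 n) {a : Jet ι 𝔨}
    (ha : ∀ N, a - ∑ n ∈ Finset.range (N + 1), u n ∈ orderGE ι 𝔨 (N + 1)) : HasSum u a := by
  rw [HasSum, SummationFilter.unconditional_filter, jetTopology, nhds_iInf,
    Filter.tendsto_iInf]
  intro m
  let _ : TopologicalSpace 𝔨 := moduleTopology ℝ 𝔨
  rw [nhds_induced, Filter.tendsto_comap_iff]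
  refine tendsto_const_nhds.congr' ?_
  filter_upwards [Filter.eventually_ge_atTop (Finset.range (m.degree + 1))] with s hs
  have h1 := ha m.degree m (by omega)
  rw [map_sub, sub_eq_zero] at h1
  rw [Function.comp_apply, h1, map_sum, map_sum]
  refine Finset.sum_subset hs fun n _ hn ↦ hu n m ?_
  simpa using hn

section Coordinates

variable {κ : Type*} [Fintype κ] (b : Module.Basis κ ℝ 𝔨)

lemma exists_eq_sum_tmul (x : Jet ι 𝔨) :
    ∃ f : κ → FormalSeries ι, x = ∑ i, f i ⊗ₜ[ℝ] b i := by
  induction x using TensorProduct.induction_on with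
  | zero => exact ⟨0, by simp⟩
  | add x y hx hy =>
    obtain ⟨f, rfl⟩ := hx
    obtain ⟨g, rfl⟩ := hy
    exact ⟨f + g, by simp [TensorProduct.add_tmul, Finset.sum_add_distrib]⟩
  | tmul f X =>
    refine ⟨fun i ↦ b.repr X i • f, ?_⟩
    conv_lhs => rw [← b.sum_repr X, TensorProduct.tmul_sum]
    simp [TensorProduct.smul_tmul]

lemma coeff_eq_repr_coeffAt (f : κ → FormalSeries ι) (m : ι →₀ ℕ) (i : κ) :
    MvPowerSeries.coeff m (f i) = b.repr (coeffAt m (∑ i, f i ⊗ₜ[ℝ] b i)) i := by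
  classical
  rw [map_sum]
  simp [Finsupp.single_apply]

end Coordinates

variable [FiniteDimensional ℝ 𝔨]

lemma eq_zero_of_coeffAt {x : Jet ι 𝔨} (h : ∀ m, coeffAt m x = 0) : x = 0 := by
  obtain ⟨f, rfl⟩ := exists_eq_sum_tmul (Module.finBasis ℝ 𝔨) x
  refine Finset.sum_eq_zero fun i _ ↦ ?_
  have : f i = 0 := by
    ext m
    rw [coeff_eq_repr_coeffAt (Module.finBasis ℝ 𝔨) f, h]
    simp
  rw [this, TensorProduct.zero_tmul]

lemma eq_zero_of_forall_mem_orderGE {x : Jet ι 𝔨} (h : ∀ k, x ∈ orderGE ι 𝔨 k) : x = 0 :=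
  eq_zero_of_coeffAt fun m ↦ h (m.degree + 1) m (by omega)

/-- Finite-dimensionality of `𝔨` makes the algebraic tensor product contain all `𝔨`-valued formal
series. -/
lemma exists_coeffAt_eq (c : (ι →₀ ℕ) → 𝔨) : ∃ x : Jet ι 𝔨, ∀ m, coeffAt m x = c m := by
  let b := Module.finBasis ℝ 𝔨
  let f : Fin (Module.finrank ℝ 𝔨) → FormalSeries ι := fun i m ↦ b.repr (c m) i
  refine ⟨∑ i, f i ⊗ₜ[ℝ] b i, fun m ↦ b.ext_elem fun i ↦ ?_⟩
  rw [← coeff_eq_repr_coeffAt]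
  rfl

lemma lieDeriv_mem_orderGE [Finite ι] (v : VectorFields ι) {k : ℕ} {x : Jet ι 𝔨}
    (hx : x ∈ orderGE ι 𝔨 k) : lieDeriv v x ∈ orderGE ι 𝔨 k := by
  obtain ⟨f, rfl⟩ := exists_eq_sum_tmul (Module.finBasis ℝ 𝔨) x
  intro m hm
  rw [map_sum, map_sum]
  refine Finset.sum_eq_zero fun i _ ↦ ?_
  rw [lieDeriv_tmul, coeffAt_tmul, coeff_vectorField_eq_zero v (f i) _ m hm, zero_smul]
  intro n hn
  rw [coeff_eq_repr_coeffAt (Module.finBasis ℝ 𝔨) f, hx n hn]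
  simp

/-- The jets are complete for the filtration by order. -/
lemma exists_forall_sub_mem_orderGE (u : ℕ → Jet ι 𝔨)
    (hu : ∀ k, u (k + 1) - u k ∈ orderGE ι 𝔨 (k + 1)) :
    ∃ x, ∀ k, x - u k ∈ orderGE ι 𝔨 (k + 1) := by
  -- The coefficient at `m` no longer changes from index `m.degree` on.
  obtain ⟨x, hx⟩ := exists_coeffAt_eq (fun m ↦ coeffAt m (u m.degree))
  refine ⟨x, fun k m hm ↦ ?_⟩
  rw [map_sub, hx, sub_eq_zero]
  obtain ⟨d, rfl⟩ := Nat.exists_eq_add_of_le (Nat.lt_succ_iff.mp hm)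
  clear hm
  induction d with
  | zero => rfl
  | succ d ih =>
    rw [ih, eq_comm, ← sub_eq_zero, ← map_sub]
    exact hu (m.degree + d) m (by omega)

lemma exists_hasSum {u : ℕ → Jet ι 𝔨} (hu : ∀ n, u n ∈ orderGE ι 𝔨 n) :
    ∃ a, HasSum u a ∧ ∀ N, a - ∑ n ∈ Finset.range (N + 1), u n ∈ orderGE ι 𝔨 (N + 1) := by
  obtain ⟨a, ha⟩ := exists_forall_sub_mem_orderGE (fun N ↦ ∑ n ∈ Finset.range (N + 1), u n)
    fun k ↦ by
      rw [Finset.sum_range_succ _ (k + 1), add_sub_cancel_left]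
      exact hu _
  exact ⟨a, hasSum_of_sub_mem hu ha, ha⟩

end JetAlgebra

end

/-! ### Semidirect sums and gauge transformations -/

namespace LieAlgebra

open scoped Nat

variable {K L S : Type*} [Field K] [LieRing L] [LieAlgebra K L] [LieRing S] [LieAlgebra K S]

/-- The Lie algebra homomorphism to derivations defined by an action by derivations. -/
def derivationHom (D : L →ₗ[K] Module.End K S)
    (hleib : ∀ p x y, D p ⁅x, y⁆ = ⁅x, D p y⁆ + ⁅D p x, y⁆)
    (hlie : ∀ p q x, D ⁅p, q⁆ x = D p (D q x) - D q (D p x)) :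
    L →ₗ⁅K⁆ LieDerivation K S S where
  toFun p :=
    { toLinearMap := D p
      leibniz' := fun x y ↦ by
        rw [hleib, ← lie_skew (D p x) y]
        abel }
  map_add' p q := by
    ext x
    exact LinearMap.congr_fun (D.map_add p q) x
  map_smul' c p := by
    ext x
    exact LinearMap.congr_fun (D.map_smul c p) x
  map_lie' := by
    intro p q
    ext x
    exact hlie p q x

namespace SemiDirectSum

variable (ψ : L →ₗ⁅K⁆ LieDerivation K S S)

/-- The filtration of a semidirect sum induced by a filtration of its ideal. -/
def filtration (F : ℕ → Submodule K S) (k : ℕ) : Submodule K (S ⋊⁅ψ⁆ L) where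
  -- The factor `L` is placed in degree zero.
  carrier := {s | s.left ∈ F k ∧ (k ≠ 0 → s.right = 0)}
  add_mem' := by
    rintro ⟨a, p⟩ ⟨b, q⟩ ⟨ha, hp⟩ ⟨hb, hq⟩
    exact ⟨add_mem ha hb, fun hk ↦ by simp_all⟩
  zero_mem' := ⟨zero_mem _, fun _ ↦ rfl⟩
  smul_mem' := by
    rintro c ⟨a, p⟩ ⟨ha, hp⟩
    exact ⟨Submodule.smul_mem _ c ha, fun hk ↦ by simp_all⟩

variable {ψ} {F : ℕ → Submodule K S}

lemma mem_filtration {k : ℕ} {s : S ⋊⁅ψ⁆ L} :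
    s ∈ filtration ψ F k ↔ s.left ∈ F k ∧ (k ≠ 0 → s.right = 0) := Iff.rfl

lemma isFiltration (hF : IsFiltration F) (hψ : ∀ p k x, x ∈ F k → ψ p x ∈ F k) :
    IsFiltration (filtration ψ F) where
  zero := by
    ext s
    simp [mem_filtration, hF.zero]
  anti := fun i j h s hs ↦ ⟨hF.anti h hs.1, fun hi ↦ hs.2 (by omega)⟩
  lie_mem := by
    rintro i j ⟨x, p⟩ ⟨y, q⟩ ⟨hx, hp⟩ ⟨hy, hq⟩
    simp only at hx hp hy hq
    refine ⟨?_, fun h ↦ ?_⟩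
    · change ⁅x, y⁆ + ψ p y - ψ q x ∈ F (i + j)
      refine sub_mem (add_mem (hF.lie_mem hx hy) ?_) ?_
      · by_cases hi : i = 0
        · subst hi
          simpa using hψ p j y hy
        · simp [hp hi]
      · by_cases hj : j = 0
        · subst hj
          simpa using hψ q i x hx
        · simp [hq hj]
    · change ⁅p, q⁆ = 0
      by_cases hi : i = 0
      · rw [hq (by omega), lie_zero]
      · rw [hp hi, zero_lie]

lemma left_sum {α : Type*} (s : Finset α) (f : α → S ⋊⁅ψ⁆ L) :
    (∑ a ∈ s, f a).left = ∑ a ∈ s, (f a).left :=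
  map_sum (projl ψ) f s

/-- The first bracket gives `(⁅ξ, x⁆ - ψ p ξ, 0)` and kills the `L`-component; afterwards only `ad
ξ` acts. The shift between the two powers produces the factorials `(n + 1)!` of `F`. -/
lemma ad_pow_succ_mk (ξ x : S) (p : L) (n : ℕ) :
    ((ad K (S ⋊⁅ψ⁆ L) ⟨ξ, 0⟩) ^ (n + 1)) ⟨x, p⟩ =
      ⟨((ad K S ξ) ^ (n + 1)) x - ((ad K S ξ) ^ n) (ψ p ξ), 0⟩ := by
  induction n with
  | zero => ext <;> simp
  | succ n ih =>
    rw [pow_succ', Module.End.mul_apply, ih, pow_succ' _ (n + 1), pow_succ' _ n]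
    ext <;> simp

lemma left_expAdPartial (ξ x : S) (p : L) (N : ℕ) :
    (expAdPartial K (N + 1) (⟨ξ, 0⟩ : S ⋊⁅ψ⁆ L) ⟨x, p⟩).left =
      ∑ n ∈ Finset.range (N + 1), (n ! : K)⁻¹ • ((ad K S ξ) ^ n) x -
        ∑ n ∈ Finset.range N, ((n + 1)! : K)⁻¹ • ((ad K S ξ) ^ n) (ψ p ξ) := by
  rw [expAdPartial_apply, left_sum, Finset.sum_range_succ', Finset.sum_range_succ' _ N]
  simp only [ad_pow_succ_mk, smul_eq_mk, smul_sub, Finset.sum_sub_distrib]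
  simp
  abel

end SemiDirectSum

/-- Solutions of the Maurer-Cartan equation for a semisimple Lie algebra acting by derivations
on a complete filtered Lie algebra are gauge equivalent if they agree modulo `F 1`. -/
theorem exists_gauge_sub_mem [CharZero K] [FiniteDimensional K L] [IsSemisimple K L]
    {F : ℕ → Submodule K S} (hF : IsFiltration F)
    (hfin : ∀ k, FiniteDimensional K (F k ⧸ (F (k + 1)).submoduleOf (F k)))
    (hcomplete : ∀ u : ℕ → S, (∀ k, u (k + 1) - u k ∈ F (k + 1)) → ∃ z, ∀ k, z - u k ∈ F (k + 1))
    (D : L →ₗ[K] Module.End K S)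
    (hleib : ∀ p x y, D p ⁅x, y⁆ = ⁅x, D p y⁆ + ⁅D p x, y⁆)
    (hlie : ∀ p q x, D ⁅p, q⁆ x = D p (D q x) - D q (D p x))
    (hD : ∀ p k x, x ∈ F k → D p x ∈ F k)
    (σ τ : L →ₗ[K] S)
    (hσ : ∀ p q, σ ⁅p, q⁆ = ⁅σ p, σ q⁆ + D p (σ q) - D q (σ p))
    (hτ : ∀ p q, τ ⁅p, q⁆ = ⁅τ p, τ q⁆ + D p (τ q) - D q (τ p))
    (hστ : ∀ p, σ p - τ p ∈ F 1) :
    ∃ ξ ∈ F 1, ∀ N p, ∑ n ∈ Finset.range (N + 1), (n ! : K)⁻¹ • ((ad K S ξ) ^ n) (σ p) -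
      ∑ n ∈ Finset.range N, ((n + 1)! : K)⁻¹ • ((ad K S ξ) ^ n) (D p ξ) - τ p ∈ F (N + 1) := by
  let ψ := derivationHom D hleib hlie
  have hψ : ∀ p x, ψ p x = D p x := fun _ _ ↦ rfl
  let lift (ρ : L →ₗ[K] S) (hρ : ∀ p q, ρ ⁅p, q⁆ = ⁅ρ p, ρ q⁆ + D p (ρ q) - D q (ρ p)) :
      L →ₗ⁅K⁆ S ⋊⁅ψ⁆ L :=
    { toFun := fun p ↦ ⟨ρ p, p⟩
      map_add' := fun p q ↦ by simp
      map_smul' := fun c p ↦ by simp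
      map_lie' := fun {p q} ↦ by simp [hρ, hψ] }
  have hG := SemiDirectSum.isFiltration (ψ := ψ) hF hD
  obtain ⟨⟨ξ, p₀⟩, hξ, h⟩ := hG.exists_expAdPartial_sub_mem (L := L) (fun k ↦ by
      let θ : SemiDirectSum.filtration ψ F k →ₗ[K]
          (F k ⧸ (F (k + 1)).submoduleOf (F k)) × L :=
        LinearMap.prod
          ((Submodule.mkQ _) ∘ₗ
            (((SemiDirectSum.projl ψ) ∘ₗ (SemiDirectSum.filtration ψ F k).subtype).codRestrict
              (F k) fun s ↦ s.2.1))
          ((SemiDirectSum.projr ψ : (S ⋊⁅ψ⁆ L) →ₗ[K] L) ∘ₗ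
            (SemiDirectSum.filtration ψ F k).subtype)
      have hle : LinearMap.ker θ ≤ (SemiDirectSum.filtration ψ F (k + 1)).submoduleOf
          (SemiDirectSum.filtration ψ F k) := by
        rintro ⟨⟨x, p⟩, hx⟩ h
        obtain ⟨h1, h2⟩ := Prod.mk.inj (LinearMap.mem_ker.mp h)
        have hx' : (⟨x, hx.1⟩ : F k) ∈ (F (k + 1)).submoduleOf (F k) :=
          (Submodule.Quotient.mk_eq_zero _).mp h1
        exact ⟨hx', fun _ ↦ h2⟩
      have := hfin k
      have : FiniteDimensional K (_ ⧸ LinearMap.ker θ) :=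
        Module.Finite.equiv θ.quotKerEquivRange.symm
      exact Module.Finite.of_surjective (Submodule.factor hle) (Submodule.factor_surjective hle))
    (fun u hu ↦ by
      obtain ⟨z, hz⟩ := hcomplete (fun k ↦ (u k).left) fun k ↦ (hu k).1
      have hr : ∀ k, (u k).right = (u 0).right := fun k ↦ by
        induction k with
        | zero => rfl
        | succ k ih =>
          rw [← ih]
          exact sub_eq_zero.mp ((hu k).2 (by omega))
      exact ⟨⟨z, (u 0).right⟩, fun k ↦ ⟨hz k, fun _ ↦ sub_eq_zero.mpr (hr k).symm⟩⟩)
    (lift σ hσ) (lift τ hτ) (fun p ↦ ⟨hστ p, fun _ ↦ sub_self p⟩)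
  -- Membership in degree one leaves only the `S`-component of the conjugating element.
  obtain rfl : p₀ = 0 := hξ.2 (by omega)
  refine ⟨ξ, hξ.1, fun N p ↦ ?_⟩
  have := (h N p).1
  rw [SemiDirectSum.sub_eq_mk] at this
  change (expAdPartial K (N + 1) (⟨ξ, 0⟩ : S ⋊⁅ψ⁆ L) ⟨σ p, p⟩).left - τ p ∈ F (N + 1) at this
  rwa [SemiDirectSum.left_expAdPartial] at this

end LieAlgebra

/-! ### Gauge equivalence of jets and the compact case -/

noncomputable section

/-- A subquotient on which finitely many linear maps to a finite-dimensional space are jointly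
injective is finite-dimensional. -/
lemma Submodule.finiteDimensional_quotient_of_forall_eq_zero {K V W α : Type*} [Field K]
    [AddCommGroup V] [Module K V] [AddCommGroup W] [Module K W] [FiniteDimensional K W] [Finite α]
    (c : α → V →ₗ[K] W) (A B : Submodule K V) (h : ∀ x ∈ A, (∀ i, c i x = 0) → x ∈ B) :
    FiniteDimensional K (A ⧸ B.submoduleOf A) := by
  let θ : A →ₗ[K] α → W := LinearMap.pi fun i ↦ c i ∘ₗ A.subtype
  have hle : LinearMap.ker θ ≤ B.submoduleOf A :=
    fun x hx ↦ h x x.2 fun i ↦ congrFun (LinearMap.mem_ker.mp hx) i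
  have : FiniteDimensional K (A ⧸ LinearMap.ker θ) :=
    Module.Finite.equiv θ.quotKerEquivRange.symm
  exact Module.Finite.of_surjective (Submodule.factor hle) (Submodule.factor_surjective hle)

namespace JetAlgebra

variable {ι : Type*} {𝔨 𝔭 : Type*} [LieRing 𝔨] [LieAlgebra ℝ 𝔨] [LieRing 𝔭] [LieAlgebra ℝ 𝔭]

lemma isFiltration_orderGE : LieAlgebra.IsFiltration (orderGE ι 𝔨) where
  zero := eq_top_iff.mpr fun x _ ↦ mem_orderGE_zero x
  anti := orderGE_antitone
  lie_mem := lie_mem_orderGE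

lemma ad_pow_apply_eq (ξ x : Jet ι 𝔨) (n : ℕ) :
    ((LieAlgebra.ad (FormalSeries ι) (Jet ι 𝔨) ξ) ^ n) x =
      ((LieAlgebra.ad ℝ (Jet ι 𝔨) ξ) ^ n) x := by
  induction n with
  | zero => rfl
  | succ n ih => rw [pow_succ', pow_succ', Module.End.mul_apply, Module.End.mul_apply, ih]; rfl

/-- Solutions of the Maurer-Cartan equation with the same value at the origin are gauge
equivalent. -/
theorem gaugeEquivalent_of_ev₀_eq [Finite ι] [FiniteDimensional ℝ 𝔨] [FiniteDimensional ℝ 𝔭]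
    [LieAlgebra.IsSemisimple ℝ 𝔭] (v : 𝔭 →ₗ[ℝ] VectorFields ι)
    (hv : ∀ p q : 𝔭, v ⁅p, q⁆ = ⁅v q, v p⁆) (σ τ : 𝔭 →ₗ[ℝ] Jet ι 𝔨) (hσ : MaurerCartan v σ)
    (hτ : MaurerCartan v τ) (h : ∀ p, ev₀ (σ p) = ev₀ (τ p)) : GaugeEquivalent v σ τ := by
  refine ⟨hσ, hτ, ?_⟩
  -- The sign turns the homomorphism to the opposite algebra into an action of `𝔭`.
  let D : 𝔭 →ₗ[ℝ] Module.End ℝ (Jet ι 𝔨) :=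
    { toFun := fun p ↦ -lieDeriv (v p)
      map_add' := fun p q ↦ by
        refine LinearMap.ext fun x ↦ ?_
        simp [lieDeriv_add, add_comm]
      map_smul' := fun c p ↦ by
        refine LinearMap.ext fun x ↦ ?_
        simp [lieDeriv_smul] }
  have hDp : ∀ p x, D p x = -lieDeriv (v p) x := fun _ _ ↦ rfl
  have hMC : ∀ ρ : 𝔭 →ₗ[ℝ] Jet ι 𝔨, MaurerCartan v ρ →
      ∀ p q, ρ ⁅p, q⁆ = ⁅ρ p, ρ q⁆ + D p (ρ q) - D q (ρ p) := fun ρ hρ p q ↦ by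
    rw [hDp, hDp, ← sub_eq_zero, ← neg_eq_zero, ← hρ p q]
    abel
  obtain ⟨ξ, hξ, hmain⟩ := LieAlgebra.exists_gauge_sub_mem isFiltration_orderGE
    (fun k ↦ by
      have : Finite {m : ι →₀ ℕ // m.degree ≤ k} := Finsupp.finite_of_degree_le k
      exact Submodule.finiteDimensional_quotient_of_forall_eq_zero
        (fun m : {m : ι →₀ ℕ // m.degree ≤ k} ↦ coeffAt m.1) _ _
        fun x _ h m hm ↦ h ⟨m, by omega⟩)
    exists_forall_sub_mem_orderGE D
    (fun p x y ↦ by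
      rw [hDp, hDp, hDp]
      have h1 := lieDeriv_lie (v p) x y
      have h2 := lie_neg x (lieDeriv (v p) y)
      have h3 := neg_lie (lieDeriv (v p) x) y
      refine (congrArg Neg.neg h1).trans ?_
      rw [h2, h3, neg_add])
    (fun p q x ↦ by
      simp only [hDp, hv, lieDeriv_commutator, map_neg]
      abel)
    (fun p k x hx ↦ neg_mem (lieDeriv_mem_orderGE (v p) hx)) σ τ (hMC σ hσ) (hMC τ hτ)
    (fun p ↦ mem_orderGE_one.mpr (by rw [map_sub, h, sub_self]))
  refine ⟨ξ, fun p ↦ ?_⟩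
  have hpow := fun x n ↦ isFiltration_orderGE.ad_pow_mem hξ x n
  obtain ⟨a, ha, ha'⟩ := exists_hasSum
    (u := fun n ↦ (n ! : ℝ)⁻¹ • ((LieAlgebra.ad (FormalSeries ι) (Jet ι 𝔨) ξ) ^ n) (σ p))
    (fun n ↦ Submodule.smul_mem _ _ (by rw [ad_pow_apply_eq]; exact hpow _ n))
  obtain ⟨b, hb, hb'⟩ := exists_hasSum
    (u := fun n ↦ -(((n + 1)! : ℝ)⁻¹ •
      ((LieAlgebra.ad (FormalSeries ι) (Jet ι 𝔨) ξ) ^ n) (-lieDeriv (v p) ξ)))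
    (fun n ↦ neg_mem (Submodule.smul_mem _ _ (by rw [ad_pow_apply_eq]; exact hpow _ n)))
  refine ⟨a, b, ha, hb, ?_⟩
  refine (sub_eq_zero.mp (eq_zero_of_forall_mem_orderGE fun k ↦ ?_)).symm
  have hb'' := hb' k
  rw [Finset.sum_range_succ] at hb''
  -- The estimate for `b` has one term more than `hmain`. That term only has order `k`, which
  -- suffices since `k` is arbitrary.
  have hlast : -(((k + 1)! : ℝ)⁻¹ •
      ((LieAlgebra.ad (FormalSeries ι) (Jet ι 𝔨) ξ) ^ k) (-lieDeriv (v p) ξ)) ∈ orderGE ι 𝔨 k :=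
    neg_mem (Submodule.smul_mem _ _ (by rw [ad_pow_apply_eq]; exact hpow _ k))
  have hsum := add_mem (orderGE_antitone (Nat.le_succ k)
    (add_mem (add_mem (ha' k) hb'') (hmain k p))) hlast
  convert hsum using 1
  simp only [ad_pow_apply_eq, hDp, Finset.sum_neg_distrib]
  abel

lemma maurerCartan_const (v : 𝔭 →ₗ[ℝ] VectorFields ι) (f : 𝔭 →ₗ⁅ℝ⁆ 𝔨) :
    MaurerCartan v (const ∘ₗ (f : 𝔭 →ₗ[ℝ] 𝔨)) := fun p q ↦ by
  simp only [LinearMap.comp_apply, lieDeriv_const, LieHom.coe_toLinearMap, LieHom.map_lie,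
    const_lie, neg_zero, add_zero, zero_sub]
  exact neg_add_cancel _

lemma MaurerCartan.ev₀_lie {v : 𝔭 →ₗ[ℝ] VectorFields ι} {σ : 𝔭 →ₗ[ℝ] Jet ι 𝔨}
    (hσ : MaurerCartan v σ) (p q : 𝔭) : ev₀ (σ ⁅p, q⁆) = ⁅ev₀ (σ p), ev₀ (σ q)⁆ := by
  have h := congrArg ev₀ (hσ p q)
  simp only [map_add, map_sub, map_neg, ev₀_lieDeriv, JetAlgebra.ev₀_lie, map_zero] at h
  rw [neg_zero, zero_add, zero_sub, neg_add_eq_zero] at h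
  exact h

/-- A homomorphism from a semisimple Lie algebra without compact ideals to a compact Lie algebra
vanishes. -/
lemma eq_zero_of_isCompactLieAlgebra [LieAlgebra.IsSemisimple ℝ 𝔭] (h𝔨 : IsCompactLieAlgebra 𝔨)
    (h : ∀ J : LieIdeal ℝ 𝔭, IsCompactLieAlgebra J → J = ⊥) (f : 𝔭 →ₗ⁅ℝ⁆ 𝔨) : f = 0 := by
  obtain ⟨B, hsymm, hpos, hinv⟩ := h𝔨
  -- `f` is injective on `J`, so the invariant inner product of `𝔨` pulls back to one on `J`.
  obtain ⟨J, hJ⟩ := exists_isCompl f.ker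
  have hJ0 : J = ⊥ := by
    refine h J ⟨B.comp (f.toLinearMap ∘ₗ J.toSubmodule.subtype)
      (f.toLinearMap ∘ₗ J.toSubmodule.subtype), ⟨fun x y ↦ hsymm.eq _ _⟩, ?_, fun x y z ↦ ?_⟩
    · rintro ⟨x, hx⟩ hx0
      refine hpos _ fun h0 ↦ hx0 ?_
      have : x ∈ f.ker ⊓ J := ⟨h0, hx⟩
      rw [hJ.inf_eq_bot] at this
      exact Subtype.ext this
    · change B (f ⁅(x : 𝔭), (y : 𝔭)⁆) (f z) = -B (f y) (f ⁅(x : 𝔭), (z : 𝔭)⁆)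
      rw [LieHom.map_lie, LieHom.map_lie, hinv]
  have htop : f.ker = ⊤ := by simpa [hJ0] using hJ.sup_eq_top
  ext p
  have : p ∈ f.ker := htop ▸ trivial
  exact this

end JetAlgebra

end
theorem mainTheorem7 {ι : Type*} [Finite ι]
    {𝔨 : Type*} [LieRing 𝔨] [LieAlgebra ℝ 𝔨] [FiniteDimensional ℝ 𝔨]
    [LieAlgebra.IsSimple ℝ 𝔨] (h𝔨 : JetAlgebra.IsCompactLieAlgebra 𝔨)
    {𝔭 : Type*} [LieRing 𝔭] [LieAlgebra ℝ 𝔭] [FiniteDimensional ℝ 𝔭]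
    [LieAlgebra.IsSemisimple ℝ 𝔭]
    (v : 𝔭 →ₗ[ℝ] JetAlgebra.VectorFields ι) (hv : ∀ p q : 𝔭, v ⁅p, q⁆ = ⁅v q, v p⁆)
    (σ : 𝔭 →ₗ[ℝ] JetAlgebra.Jet ι 𝔨) (hσ : JetAlgebra.MaurerCartan v σ) :
    (∃ σ₀ : 𝔭 →ₗ⁅ℝ⁆ 𝔨, (σ₀ : 𝔭 →ₗ[ℝ] 𝔨) = JetAlgebra.ev₀ ∘ₗ σ ∧
      JetAlgebra.GaugeEquivalent v σ (JetAlgebra.const ∘ₗ (σ₀ : 𝔭 →ₗ[ℝ] 𝔨))) ∧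
    ((∀ J : LieIdeal ℝ 𝔭, JetAlgebra.IsCompactLieAlgebra J → J = ⊥) →
      JetAlgebra.GaugeEquivalent v σ 0) := by
  let σ₀ : 𝔭 →ₗ⁅ℝ⁆ 𝔨 :=
    { JetAlgebra.ev₀ ∘ₗ σ with map_lie' := fun {p q} ↦ hσ.ev₀_lie p q }
  have hσ₀ : (σ₀ : 𝔭 →ₗ[ℝ] 𝔨) = JetAlgebra.ev₀ ∘ₗ σ := rfl
  have hgauge : JetAlgebra.GaugeEquivalent v σ (JetAlgebra.const ∘ₗ (σ₀ : 𝔭 →ₗ[ℝ] 𝔨)) :=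
    JetAlgebra.gaugeEquivalent_of_ev₀_eq v hv σ _ hσ (JetAlgebra.maurerCartan_const v σ₀)
      fun p ↦ (JetAlgebra.ev₀_const (σ₀ p)).symm
  refine ⟨⟨σ₀, hσ₀, hgauge⟩, fun h ↦ ?_⟩
  have h0 : JetAlgebra.const ∘ₗ (σ₀ : 𝔭 →ₗ[ℝ] 𝔨) = (0 : 𝔭 →ₗ[ℝ] JetAlgebra.Jet ι 𝔨) := by
    ext1 p
    simp [JetAlgebra.eq_zero_of_isCompactLieAlgebra h𝔨 h σ₀]
  rwa [h0] at hgauge
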